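/- **Embedding.** Let $G_E=(V_E,E_E)$ be a finite graph (parallel edges allowed) with $N_E=|V_E|$ vertices, in which every edge $e$ carries a dimension size $s_e\in\{1,2,\dots\}$ and is adjacent either to one vertex (uncontracted) or to two distinct vertices (contracted). Let $\bar E$ be a set of uncontracted edges (the input edges, connecting the embedding to the data), and let $E_1$ be the set of the other uncontracted edges (the output edges). Place at each vertex $v$ a random real tensor $\mathcal A_v$ with one index in $[s_e]$ for each edge $e$ adjacent to $v$. The tensor network embedding $\mathbf S$ is the random matrix obtained by multiplying all the tensors, summing over the indices of the contracted edges, and grouping the indices of the edges in $E_1$ into the row and those of the edges in $\bar E$ into the column. **Linearization.** A linearization is an ordering $v_1,\dots,v_{N_E}$ of the vertices. For a given linearization, $\mathbf A_i$ denotes the matricization of $\mathcal A_{v_i}$ in which the output dimensions and the contracted dimensions shared with some $v_j$, $j>i$, form the row, and the other dimensions (the input dimensions and the contracted dimensions shared with some $v_j$, $j<i$) form the column; let $m_i$ be the number of rows of $\mathbf A_i$. The embedding is Gaussian (with this linearization) if the tensors are independent and each $\mathbf A_i$ equals $m_i^{-1/2}$ times a matrix with independent $N(0,1)$ entries. **Theorem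 3.1.** For every $\delta_0\in(0,1)$ there is a constant $C>0$, depending only on $\delta_0$, such that the following holds for all $\varepsilon\in(0,1]$ and $\delta\in(0,\delta_0]$. If a Gaussian tensor network embedding $\mathbf S$ has a linearization for which $$m_i\;\ge\; C\,\frac{N_E\log(1/\delta)}{\varepsilon^2}\qquad\text{for every } i\in\{1,\dots,N_E\},$$ then $\mathbf S$ is $(\varepsilon,\delta)$-accurate: for every vector $x$ with $\|x\|_2=1$, $$\Pr\left(\left|\,\|\mathbf S x\|_2^2-1\right|>\varepsilon\right)<\delta .$$ -/

import Mathlib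

open MeasureTheory ProbabilityTheory
open scoped Matrix

universe u v w

noncomputable section

/-- The graph of a tensor network embedding, with vertex set `V` and edge set `E` (parallel edges
are allowed). Every edge represents one tensor dimension, of size `dim e ≥ 1` (the weight of `e` is
the logarithm of `dim e`). An edge is adjacent to one vertex (uncontracted) or to two distinct
vertices (contracted). The edges in `input` are the uncontracted edges that connect the embedding
to the data. -/
structure EmbeddingNetwork (V : Type u) (E : Type v) where
  ends : E → Finset V
  card_ends : ∀ e, (ends e).card = 1 ∨ (ends e).card = 2
  dim : E → ℕ
  dim_pos : ∀ e, 0 < dim e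
  input : Finset E
  input_uncontracted : ∀ e ∈ input, (ends e).card = 1

namespace EmbeddingNetwork

variable {V : Type u} {E : Type v} [Fintype V] [DecidableEq V] [Fintype E] [DecidableEq E]

/-- The uncontracted edges that are not connected to the data: the output sketch dimensions. -/
def output (G : EmbeddingNetwork V E) : Finset E :=
  Finset.univ.filter fun e => (G.ends e).card = 1 ∧ e ∉ G.input

/-- The edges adjacent to the vertex `a`. -/
def incident (G : EmbeddingNetwork V E) (a : V) : Finset E :=
  Finset.univ.filter fun e => a ∈ G.ends e

/-- Multi-indices: one index in `Fin (dim e)` for every edge `e` of the edge set `F`. -/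
abbrev Idx (G : EmbeddingNetwork V E) (F : Finset E) : Type v :=
  (e : F) → Fin (G.dim e)

/-- The space of tensors that can sit at the vertex `a`: one real entry for every multi-index over
the edges adjacent to `a`. -/
abbrev Core (G : EmbeddingNetwork V E) (a : V) : Type v :=
  G.Idx (G.incident a) → ℝ

/-- The embedding matrix: the tensor described by the network (sum, over all values of the
contracted dimensions, of the product of the tensors at the vertices), matricized with the output
dimensions as row index and the input dimensions as column index. The sum runs over all assignments
`x` of an index to every edge that take the prescribed values on the uncontracted edges. -/
def embedding (G : EmbeddingNetwork V E) (T : (a : V) → G.Core a) :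
    Matrix (G.Idx G.output) (G.Idx G.input) ℝ :=
  Matrix.of fun r c =>
    ∑ x : ((e : E) → Fin (G.dim e)),
      if (∀ e : G.output, x e = r e) ∧ (∀ e : G.input, x e = c e) then
        ∏ a : V, T a (fun e => x e)
      else 0

/-- A linearization orders the vertices of the embedding as `v₁, …, v_N` where `N` is the number of
vertices; contracted edges are then directed towards the vertex with the higher index. -/
abbrev Linearization (_G : EmbeddingNetwork V E) : Type u :=
  V ≃ Fin (Fintype.card V)

/-- The dimensions of the tensor at `a` that are grouped into the row of its matricization: the
output dimensions, and the contracted dimensions shared with a vertex of higher index. -/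
def rowEdges (G : EmbeddingNetwork V E) (σ : G.Linearization) (a : V) : Finset E :=
  (G.incident a).filter fun e => e ∈ G.output ∨ ∃ b ∈ G.ends e, σ a < σ b

/-- The remaining dimensions of the tensor at `a`: the input dimensions, and the contracted
dimensions shared with a vertex of lower index. -/
def colEdges (G : EmbeddingNetwork V E) (σ : G.Linearization) (a : V) : Finset E :=
  G.incident a \ G.rowEdges σ a

/-- The matricization of a tensor `t` at the vertex `a` in the linearization `σ`. -/
def coreMatrix (G : EmbeddingNetwork V E) (σ : G.Linearization) (a : V) (t : G.Core a) :
    Matrix (G.Idx (G.rowEdges σ a)) (G.Idx (G.colEdges σ a)) ℝ :=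
  Matrix.of fun r c => t fun e =>
    if h : (e : E) ∈ G.rowEdges σ a then r ⟨e, h⟩
    else c ⟨e, Finset.mem_sdiff.mpr ⟨e.2, h⟩⟩

/-- The row size of the matricized tensor at the vertex `a`: its number of rows. -/
def rowSize (G : EmbeddingNetwork V E) (σ : G.Linearization) (a : V) : ℕ :=
  Fintype.card (G.Idx (G.rowEdges σ a))

end EmbeddingNetwork

/-- A random matrix `S` with `m` rows is a Gaussian embedding if `S = M / √m` where the entries of
`M` are independent standard Gaussian random variables. -/
def IsGaussianEmbedding {Ω : Type w} [MeasurableSpace Ω] (P : Measure Ω)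
    {m n : Type v} [Fintype m] (S : Ω → Matrix m n ℝ) : Prop :=
  ∃ M : m × n → Ω → ℝ,
    (∀ k, HasLaw (M k) (gaussianReal 0 1) P) ∧ iIndepFun M P ∧
      ∀ ω i j, S ω i j = 1 / √(Fintype.card m : ℝ) * M (i, j) ω

/-- The random tensors `A` at the vertices are those of a Gaussian tensor network embedding, with
linearization `σ`: they are independent, and each of them, matricized according to `σ`, is a
Gaussian embedding. -/
def EmbeddingNetwork.IsGaussian {V : Type u} {E : Type v} [Fintype V] [DecidableEq V] [Fintype E]
    [DecidableEq E] {Ω : Type w} [MeasurableSpace Ω] (G : EmbeddingNetwork V E)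
    (σ : G.Linearization) (P : Measure Ω) (A : (a : V) → Ω → G.Core a) : Prop :=
  iIndepFun A P ∧ ∀ a, IsGaussianEmbedding P fun ω => G.coreMatrix σ a (A a ω)

/-- The `(ε, δ)`-accurate embedding property of a random matrix: for every vector `x` of Euclidean
norm one, `|‖S x‖² - 1| > ε` has probability less than `δ`. -/
def IsAccurateEmbedding {Ω : Type w} [MeasurableSpace Ω] (P : Measure Ω)
    {m n : Type v} [Fintype m] [Fintype n] (S : Ω → Matrix m n ℝ) (ε δ : ℝ) : Prop :=
  ∀ x : EuclideanSpace ℝ n, ‖x‖ = 1 →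
    P.real {ω | ε < |‖WithLp.toLp 2 (S ω *ᵥ x.ofLp)‖ ^ 2 - 1|} < δ

end

/-!
Apply the tensors to the data one vertex at a time, in the order of the linearization. At each
vertex the data is contracted with an independent Gaussian matrix with `m` rows, which acts on every
slice of the current sketch. For a fixed vector, the squared norm of its image is its squared norm
times a rescaled chi-square variable, whose `p`-th moment is at most `exp (4p² / m)` for all real
`p` with `1 ≤ |p| ≤ m / 4`, of both signs. By Minkowski's inequality, and by convexity of `x ↦ xᵖ`
for negative `p`, the bound passes to sums over the slices, although these are dependent. By
independence the factors multiply along the linearization, so the `p`-th moment of `‖S x‖²` is at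
most `exp (∑ a, 4p² / m a)`, and Markov's inequality for `p = ± B ε / 16`, where `m a ≥ N B`, bounds
both tails.
-/

open scoped Topology

/-! ### Moments of the gamma distribution -/

theorem log_Gamma_sub_log_Gamma {x : ℝ} (hx : 0 < x) :
    Real.log (Real.Gamma (x + 1)) - Real.log (Real.Gamma x) = Real.log x := by
  rw [Real.Gamma_add_one hx.ne', Real.log_mul hx.ne' (Real.Gamma_pos_of_pos hx).ne',
    add_sub_cancel_right]

theorem Gamma_add_le_rpow_mul_Gamma {a p : ℝ} (ha : 0 < a) (hap : 0 < a + p) (hp : 1 ≤ |p|) :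
    Real.Gamma (a + p) ≤ (a + p) ^ p * Real.Gamma a := by
  have hΓ := Real.Gamma_pos_of_pos ha
  rw [← Real.log_le_log_iff (Real.Gamma_pos_of_pos hap) (by positivity),
    Real.log_mul (by positivity) hΓ.ne', Real.log_rpow hap, ← log_Gamma_sub_log_Gamma hap]
  have hcvx := Real.convexOn_log_Gamma
  have hap1 : 0 < a + p + 1 := by linarith
  rcases le_abs'.mp hp with hp | hp
  · have := hcvx.secant_mono (a := a + p) (x := a + p + 1) (y := a) hap hap1 ha (by linarith)
      (by linarith) (by linarith)
    rw [add_sub_cancel_left, div_one, sub_add_cancel_left, le_div_iff₀ (by linarith)] at this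
    simp only [Function.comp_apply] at this
    linarith
  · have := hcvx.slope_mono_adjacent (x := a) (y := a + p) (z := a + p + 1) ha hap1 (by linarith)
      (by linarith)
    rw [add_sub_cancel_left, add_sub_cancel_left, div_one, div_le_iff₀ (by linarith)] at this
    simp only [Function.comp_apply] at this
    linarith

theorem Gamma_add_div_Gamma_div_rpow_le_exp {a p : ℝ} (ha : 0 < a) (hp : 1 ≤ |p|)
    (hpa : |p| ≤ a / 2) :
    Real.Gamma (a + p) / Real.Gamma a / a ^ p ≤ Real.exp (2 * p ^ 2 / a) := by
  have hpa' : -(a / 2) ≤ p := (abs_le.mp hpa).1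
  have hap : 0 < a + p := by linarith
  have hlog : p * Real.log ((a + p) / a) ≤ 2 * p ^ 2 / a := by
    rcases le_total 0 p with hp₀ | hp₀
    · calc p * Real.log ((a + p) / a) ≤ p * ((a + p) / a - 1) :=
            mul_le_mul_of_nonneg_left (Real.log_le_sub_one_of_pos (by positivity)) hp₀
        _ = p ^ 2 / a := by field_simp; ring
        _ ≤ 2 * p ^ 2 / a := by gcongr; linarith [sq_nonneg p]
    · calc p * Real.log ((a + p) / a) ≤ p * (1 - ((a + p) / a)⁻¹) :=
            mul_le_mul_of_nonpos_left (Real.one_sub_inv_le_log_of_pos (by positivity)) hp₀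
        _ = p ^ 2 / (a + p) := by field_simp; ring
        _ ≤ 2 * p ^ 2 / a := by
          rw [div_le_div_iff₀ hap ha]
          nlinarith [mul_nonneg (sq_nonneg p) (by linarith : 0 ≤ a + 2 * p)]
  calc Real.Gamma (a + p) / Real.Gamma a / a ^ p ≤ (a + p) ^ p / a ^ p := by
        gcongr
        exact (div_le_iff₀ (Real.Gamma_pos_of_pos ha)).mpr (Gamma_add_le_rpow_mul_Gamma ha hap hp)
    _ = Real.exp (p * Real.log ((a + p) / a)) := by
        rw [← Real.div_rpow hap.le ha.le, Real.rpow_def_of_pos (by positivity), mul_comm]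
    _ ≤ Real.exp (2 * p ^ 2 / a) := Real.exp_le_exp.mpr hlog

theorem map_eq_map_of_mgf_eventuallyEq {Ω Ω' : Type*} [MeasurableSpace Ω] [MeasurableSpace Ω']
    {μ : Measure Ω} {ν : Measure Ω'} [IsProbabilityMeasure μ] [IsProbabilityMeasure ν]
    {X : Ω → ℝ} {Y : Ω' → ℝ} (hX : AEMeasurable X μ) (hY : AEMeasurable Y ν)
    (hX₀ : 0 ∈ interior (integrableExpSet X μ)) (h : mgf X μ =ᶠ[𝓝 0] mgf Y ν) :
    μ.map X = ν.map Y := by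
  have hY₀ : 0 ∈ interior (integrableExpSet Y ν) := by
    rw [mem_interior_iff_mem_nhds] at hX₀ ⊢
    filter_upwards [hX₀, h] with t htX htXY
    exact mgf_pos_iff.mp (htXY ▸ mgf_pos htX)
  set U : Set ℂ :=
    Complex.re ⁻¹' (interior (integrableExpSet X μ) ∩ interior (integrableExpSet Y ν)) with hU
  have hUconn : IsPreconnected U :=
    ((convex_integrableExpSet.interior.inter convex_integrableExpSet.interior).linear_preimage
      Complex.reLm).isPreconnected
  have hfreq : ∃ᶠ z in 𝓝[≠] (0 : ℂ), complexMGF X μ z = complexMGF Y ν z := by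
    have hne : (𝓝[≠] (0 : ℝ)).map Complex.ofReal ≤ 𝓝[≠] (0 : ℂ) :=
      tendsto_nhdsWithin_iff.mpr
        ⟨(Complex.continuous_ofReal.tendsto' 0 0 Complex.ofReal_zero).mono_left nhdsWithin_le_nhds,
          by filter_upwards [self_mem_nhdsWithin] with t ht using by simpa using ht⟩
    refine Filter.Frequently.filter_mono (Filter.frequently_map.mpr ?_) hne
    refine Filter.Eventually.frequently ?_
    filter_upwards [h.filter_mono nhdsWithin_le_nhds] with t ht
    rw [complexMGF_ofReal, complexMGF_ofReal, ht]
  have heq : Set.EqOn (complexMGF X μ) (complexMGF Y ν) U :=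
    (analyticOnNhd_complexMGF.mono fun _ hz => hz.1).eqOn_of_preconnected_of_frequently_eq
      (analyticOnNhd_complexMGF.mono fun _ hz => hz.2) hUconn (by simpa [hU] using ⟨hX₀, hY₀⟩) hfreq
  have := Measure.isProbabilityMeasure_map hX
  have := Measure.isProbabilityMeasure_map hY
  refine Measure.ext_of_charFun (funext fun t => ?_)
  rw [← complexMGF_mul_I hX, ← complexMGF_mul_I hY]
  exact heq (by simpa [hU] using ⟨hX₀, hY₀⟩)

theorem measurable_gammaPDF (a r : ℝ) : Measurable (gammaPDF a r) :=
  (measurable_gammaPDFReal a r).ennreal_ofReal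

theorem mgf_gammaMeasure {a r t : ℝ} (ha : 0 < a) (hr : 0 < r) (ht : t < r) :
    mgf id (gammaMeasure a r) t = (r / (r - t)) ^ a := by
  have hrt : 0 < r - t := by linarith
  calc mgf id (gammaMeasure a r) t = ∫ x, gammaPDFReal a r x * Real.exp (t * x) := by
        rw [mgf, gammaMeasure, integral_withDensity_eq_integral_toReal_smul
          (measurable_gammaPDF a r) (by simp [gammaPDF])]
        simp [gammaPDF, ENNReal.toReal_ofReal (gammaPDFReal_nonneg ha hr _)]
    _ = ∫ x in Set.Ioi 0, r ^ a / Real.Gamma a * (x ^ (a - 1) * Real.exp (-((r - t) * x))) := by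
        rw [← integral_Ici_eq_integral_Ioi, ← integral_indicator measurableSet_Ici]
        congr 1 with x
        by_cases hx : x ∈ Set.Ici 0
        · rw [Set.indicator_of_mem hx, gammaPDFReal, if_pos (Set.mem_Ici.mp hx), mul_assoc,
            mul_assoc, ← Real.exp_add]
          ring_nf
        · rw [Set.indicator_of_notMem hx, gammaPDFReal, if_neg (by simpa using hx), zero_mul]
    _ = (r / (r - t)) ^ a := by
        have hΓ := (Real.Gamma_pos_of_pos ha).ne'
        rw [integral_const_mul, Real.integral_rpow_mul_exp_neg_mul_Ioi ha hrt,
          Real.div_rpow hr.le hrt.le, Real.div_rpow zero_le_one hrt.le, Real.one_rpow]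
        field_simp

theorem mgf_sq_gaussianReal {t : ℝ} (ht : t < 1 / 2) :
    mgf (fun x => x ^ 2) (gaussianReal 0 1) t = (1 / 2 / (1 / 2 - t)) ^ (1 / 2 : ℝ) := by
  have : 0 < 1 / 2 - t := by linarith
  calc mgf (fun x => x ^ 2) (gaussianReal 0 1) t
      = ∫ x, (√(2 * Real.pi))⁻¹ * Real.exp (-(1 / 2 - t) * x ^ 2) := by
        rw [mgf, integral_gaussianReal_eq_integral_smul one_ne_zero]
        congr 1 with x
        simp only [gaussianPDFReal, smul_eq_mul, NNReal.coe_one, mul_one, sub_zero]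
        rw [mul_assoc, ← Real.exp_add]
        ring_nf
    _ = (1 / 2 / (1 / 2 - t)) ^ (1 / 2 : ℝ) := by
        rw [integral_const_mul, integral_gaussian, ← Real.sqrt_eq_rpow, ← Real.sqrt_inv,
          ← Real.sqrt_mul (by positivity)]
        congr 1
        field_simp

theorem mgf_sum_sq_of_gaussianReal {Ω ι : Type*} [MeasurableSpace Ω] {P : Measure Ω} [Fintype ι]
    {X : ι → Ω → ℝ} (hX : ∀ i, HasLaw (X i) (gaussianReal 0 1) P) (hind : iIndepFun X P) {t : ℝ}
    (ht : t < 1 / 2) :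
    mgf (fun ω => ∑ i, X i ω ^ 2) P t = (1 / 2 / (1 / 2 - t)) ^ (Fintype.card ι / 2 : ℝ) := by
  have hmeas : ∀ i, AEMeasurable (X i) P := fun i => (hX i).aemeasurable
  have hmgf : ∀ i, mgf (fun ω => X i ω ^ 2) P t = (1 / 2 / (1 / 2 - t)) ^ (1 / 2 : ℝ) := fun i => by
    rw [← mgf_sq_gaussianReal ht]
    exact (hX i).integral_comp (f := fun x => Real.exp (t * x ^ 2)) (by fun_prop)
  have hsum : mgf (∑ i, fun ω => X i ω ^ 2) P t = ∏ i, mgf (fun ω => X i ω ^ 2) P t :=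
    (hind.comp (fun _ x => x ^ 2) fun _ => by fun_prop).mgf_sum₀ (fun i => by fun_prop) _
  have hbase : 0 ≤ 1 / 2 / (1 / 2 - t) := div_nonneg (by norm_num) (by linarith)
  rw [Finset.sum_fn] at hsum
  simp only [hsum, hmgf, Finset.prod_const, Finset.card_univ, ← Real.rpow_mul_natCast hbase]
  ring_nf

theorem hasLaw_sum_sq_of_gaussianReal {Ω ι : Type*} [MeasurableSpace Ω] {P : Measure Ω} [Fintype ι]
    [Nonempty ι] {X : ι → Ω → ℝ} (hX : ∀ i, HasLaw (X i) (gaussianReal 0 1) P)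
    (hind : iIndepFun X P) :
    HasLaw (fun ω => ∑ i, X i ω ^ 2) (gammaMeasure (Fintype.card ι / 2) (1 / 2)) P := by
  have := hind.isProbabilityMeasure
  have : (0 : ℝ) < Fintype.card ι := by exact_mod_cast Fintype.card_pos
  have := isProbabilityMeasure_gammaMeasure (a := Fintype.card ι / 2) (r := 1 / 2)
    (by positivity) (by norm_num)
  have hmeas : ∀ i, AEMeasurable (X i) P := fun i => (hX i).aemeasurable
  have hsum : AEMeasurable (fun ω => ∑ i, X i ω ^ 2) P := by fun_prop
  have hnhds : Set.Iio (1 / 2 : ℝ) ∈ 𝓝 0 := Iio_mem_nhds (by norm_num)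
  refine ⟨hsum, (map_eq_map_of_mgf_eventuallyEq hsum aemeasurable_id ?_ ?_).trans Measure.map_id⟩
  · rw [mem_interior_iff_mem_nhds]
    filter_upwards [hnhds] with t (ht : t < 1 / 2)
    refine mgf_pos_iff.mp ?_
    rw [mgf_sum_sq_of_gaussianReal hX hind ht]
    exact Real.rpow_pos_of_pos (div_pos (by norm_num) (by linarith)) _
  · filter_upwards [hnhds] with t (ht : t < 1 / 2)
    rw [mgf_sum_sq_of_gaussianReal hX hind ht, mgf_gammaMeasure (by positivity) (by norm_num) ht]

theorem gammaPDF_mul_ofReal_rpow {a r p x : ℝ} (ha : 0 < a) (hr : 0 < r) (hap : 0 < a + p)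
    (hx : x ≠ 0) :
    gammaPDF a r x * ENNReal.ofReal x ^ p
      = ENNReal.ofReal (Real.Gamma (a + p) / Real.Gamma a / r ^ p) * gammaPDF (a + p) r x := by
  have := Real.Gamma_pos_of_pos ha
  have := Real.Gamma_pos_of_pos hap
  rcases hx.lt_or_gt with hx | hx
  · simp [gammaPDF_of_neg hx]
  · have hxp : x ^ (a + p - 1) = x ^ (a - 1) * x ^ p := by rw [← Real.rpow_add hx]; ring_nf
    rw [gammaPDF_of_nonneg hx.le, gammaPDF_of_nonneg hx.le, ENNReal.ofReal_rpow_of_pos hx,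
      ← ENNReal.ofReal_mul (by positivity), ← ENNReal.ofReal_mul (by positivity), hxp,
      Real.rpow_add hr]
    congr 1
    field_simp

theorem lintegral_rpow_gammaMeasure {a r p : ℝ} (ha : 0 < a) (hr : 0 < r) (hap : 0 < a + p) :
    ∫⁻ x, ENNReal.ofReal x ^ p ∂gammaMeasure a r
      = ENNReal.ofReal (Real.Gamma (a + p) / Real.Gamma a / r ^ p) := by
  have hne : ∀ᵐ x : ℝ, x ≠ 0 := by simp [ae_iff]
  calc ∫⁻ x, ENNReal.ofReal x ^ p ∂gammaMeasure a r
      = ∫⁻ x, gammaPDF a r x * ENNReal.ofReal x ^ p :=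
        lintegral_withDensity_eq_lintegral_mul _ (measurable_gammaPDF a r) (by fun_prop)
    _ = ∫⁻ x, ENNReal.ofReal (Real.Gamma (a + p) / Real.Gamma a / r ^ p)
          * gammaPDF (a + p) r x :=
        lintegral_congr_ae (hne.mono fun x hx => gammaPDF_mul_ofReal_rpow ha hr hap hx)
    _ = ENNReal.ofReal (Real.Gamma (a + p) / Real.Gamma a / r ^ p) := by
        rw [lintegral_const_mul _ (measurable_gammaPDF _ _), lintegral_gammaPDF_eq_one hap hr,
          mul_one]

theorem lintegral_rpow_gammaMeasure_le_exp {a r p : ℝ} (hr : 0 < r) (hp : 1 ≤ |p|)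
    (hpa : |p| ≤ a / 2) :
    ∫⁻ x, ENNReal.ofReal x ^ p ∂gammaMeasure a r
      ≤ ENNReal.ofReal (Real.exp (2 * p ^ 2 / a)) * ENNReal.ofReal (a / r) ^ p := by
  have ha : 0 < a := by linarith
  rw [lintegral_rpow_gammaMeasure ha hr (by linarith [(abs_le.mp hpa).1]),
    ENNReal.ofReal_rpow_of_pos (by positivity), ← ENNReal.ofReal_mul (by positivity),
    Real.div_rpow ha.le hr.le, ← mul_div_assoc]
  gcongr
  rw [← div_le_iff₀ (by positivity)]
  exact Gamma_add_div_Gamma_div_rpow_le_exp ha hp hpa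

/-! ### Moments of Gaussian embeddings -/

theorem covariance_sum_mul_of_iIndepFun {Ω ι : Type*} [MeasurableSpace Ω] {P : Measure Ω}
    [Fintype ι] {X : ι → Ω → ℝ} (hX : ∀ i, MemLp (X i) 2 P) (hind : iIndepFun X P)
    (a b : ι → ℝ) :
    cov[fun ω => ∑ i, a i * X i ω, fun ω => ∑ i, b i * X i ω; P]
      = ∑ i, a i * b i * Var[X i; P] := by
  have := hind.isProbabilityMeasure
  rw [covariance_fun_sum_fun_sum (fun i => (hX i).const_mul _) (fun i => (hX i).const_mul _)]
  refine Finset.sum_congr rfl fun i _ => ?_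
  rw [Finset.sum_eq_single i]
  · rw [covariance_const_mul_left, covariance_const_mul_right, covariance_self (hX i).aemeasurable,
      mul_assoc]
  · intro j _ hji
    rw [covariance_const_mul_left, covariance_const_mul_right,
      (hind.indepFun hji.symm).covariance_eq_zero (hX i) (hX j), mul_zero, mul_zero]
  · simp

theorem hasLaw_mulVec_and_iIndepFun_of_mul_transpose_eq_one {Ω ι κ : Type*} [MeasurableSpace Ω]
    {P : Measure Ω} [Fintype ι] [Finite κ] [DecidableEq κ] {X : ι → Ω → ℝ}
    (hX : ∀ i, HasLaw (X i) (gaussianReal 0 1) P) (hind : iIndepFun X P) {L : Matrix κ ι ℝ}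
    (hL : L * Lᵀ = 1) :
    (∀ k, HasLaw (fun ω => (L *ᵥ fun i => X i ω) k) (gaussianReal 0 1) P) ∧
      iIndepFun (fun k ω => (L *ᵥ fun i => X i ω) k) P := by
  have := Fintype.ofFinite κ
  have := hind.isProbabilityMeasure
  have hL2 : ∀ i, MemLp (X i) 2 P := fun i => (hX i).hasGaussianLaw.memLp_two
  have hgauss : HasGaussianLaw (fun ω => L *ᵥ fun i => X i ω) P :=
    (iIndepFun.hasGaussianLaw (fun i => (hX i).hasGaussianLaw) hind).map_fun
      L.mulVecLin.toContinuousLinearMap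
  have hcov : ∀ k l, cov[fun ω => (L *ᵥ fun i => X i ω) k, fun ω => (L *ᵥ fun i => X i ω) l; P]
      = (1 : Matrix κ κ ℝ) k l := fun k l => by
    simp only [Matrix.mulVec, dotProduct, covariance_sum_mul_of_iIndepFun hL2 hind,
      (hX _).variance_eq, variance_id_gaussianReal, ← hL, Matrix.mul_apply, Matrix.transpose_apply,
      NNReal.coe_one, mul_one]
  refine ⟨fun k => ?_, hgauss.iIndepFun_of_covariance_eq_zero fun k l hkl => by
    rw [hcov, Matrix.one_apply_ne hkl]⟩
  have hk := hgauss.eval k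
  have hmean : ∫ ω, (L *ᵥ fun i => X i ω) k ∂P = 0 := by
    simp only [Matrix.mulVec, dotProduct]
    rw [integral_finsetSum _ fun i _ => ((hL2 i).const_mul _).integrable (by norm_num)]
    simp [integral_const_mul, (hX _).integral_eq, integral_id_gaussianReal]
  refine ⟨hk.aemeasurable, ?_⟩
  rw [hk.map_eq_gaussianReal, ← covariance_self hk.aemeasurable, hcov, hmean, Matrix.one_apply_eq,
    Real.toNNReal_one]

theorem mul_rpow_of_ne_zero_of_ne_top {a : ENNReal} (ha₀ : a ≠ 0) (ha : a ≠ ⊤) (b : ENNReal)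
    (p : ℝ) : (a * b) ^ p = a ^ p * b ^ p := by
  rw [ENNReal.mul_rpow_eq_ite, if_neg (by simp [ha₀, ha])]

theorem IsGaussianEmbedding.hasLaw_sum_mulVec_sq {Ω : Type*} {m n : Type v} [MeasurableSpace Ω]
    {P : Measure Ω} [Fintype m] [Fintype n] [Nonempty m] {S : Ω → Matrix m n ℝ}
    (hS : IsGaussianEmbedding P S) {v : n → ℝ} (hv : ∑ c, v c ^ 2 = 1) :
    HasLaw (fun ω => Fintype.card m * ∑ r, (S ω *ᵥ v) r ^ 2)
      (gammaMeasure (Fintype.card m / 2) (1 / 2)) P := by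
  classical
  obtain ⟨M, hM, hind, hSM⟩ := hS
  let L : Matrix m (m × n) ℝ := Matrix.of fun r k => if r = k.1 then v k.2 else 0
  have hL : L * Lᵀ = 1 := by
    ext r r'
    simp [L, Matrix.mul_apply, Matrix.one_apply, Fintype.sum_prod_type, ← sq, ← hv]
  have hLM : ∀ ω r, (S ω *ᵥ v) r = 1 / √(Fintype.card m : ℝ) * (L *ᵥ fun k => M k ω) r :=
    fun ω r => by
      simp [L, Matrix.mulVec, dotProduct, Fintype.sum_prod_type, hSM, Finset.mul_sum, mul_assoc,
        mul_comm (v _)]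
  obtain ⟨hlaw, hindep⟩ := hasLaw_mulVec_and_iIndepFun_of_mul_transpose_eq_one hM hind hL
  convert hasLaw_sum_sq_of_gaussianReal hlaw hindep using 2 with ω
  have : (Fintype.card m : ℝ) ≠ 0 := Nat.cast_ne_zero.mpr Fintype.card_ne_zero
  simp only [hLM, mul_pow, div_pow, one_pow, Real.sq_sqrt (Nat.cast_nonneg _), ← Finset.mul_sum]
  field_simp

theorem IsGaussianEmbedding.lintegral_rpow_sum_mulVec_sq_le_of_sum_sq_eq_one {Ω : Type*}
    {m n : Type v} [MeasurableSpace Ω] {P : Measure Ω} [Fintype m] [Fintype n] [Nonempty m]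
    {S : Ω → Matrix m n ℝ} (hS : IsGaussianEmbedding P S) {p : ℝ} (hp : 1 ≤ |p|)
    (hpm : |p| ≤ Fintype.card m / 4) {v : n → ℝ} (hv : ∑ c, v c ^ 2 = 1) :
    ∫⁻ ω, ENNReal.ofReal (∑ r, (S ω *ᵥ v) r ^ 2) ^ p ∂P
      ≤ ENNReal.ofReal (Real.exp (4 * p ^ 2 / Fintype.card m)) := by
  set W : Ω → ℝ := fun ω => Fintype.card m * ∑ r, (S ω *ᵥ v) r ^ 2 with hW
  have hm : (0 : ℝ) < Fintype.card m := Nat.cast_pos.mpr Fintype.card_pos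
  have hm₀ : ENNReal.ofReal (Fintype.card m : ℝ)⁻¹ ≠ 0 := by simp
  have hWm : ∀ ω, ∑ r, (S ω *ᵥ v) r ^ 2 = (Fintype.card m : ℝ)⁻¹ * W ω := fun ω => by
    rw [hW, inv_mul_cancel_left₀ hm.ne']
  calc ∫⁻ ω, ENNReal.ofReal (∑ r, (S ω *ᵥ v) r ^ 2) ^ p ∂P
      = ∫⁻ ω, ENNReal.ofReal (Fintype.card m : ℝ)⁻¹ ^ p * ENNReal.ofReal (W ω) ^ p ∂P := by
        simp_rw [hWm, ENNReal.ofReal_mul (inv_nonneg.mpr hm.le),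
          mul_rpow_of_ne_zero_of_ne_top hm₀ ENNReal.ofReal_ne_top]
    _ = ENNReal.ofReal (Fintype.card m : ℝ)⁻¹ ^ p
          * ∫⁻ x, ENNReal.ofReal x ^ p ∂gammaMeasure (Fintype.card m / 2) (1 / 2) := by
        rw [lintegral_const_mul' _ _ (ENNReal.rpow_ne_top_of_ne_zero hm₀ ENNReal.ofReal_ne_top),
          (hS.hasLaw_sum_mulVec_sq hv).lintegral_comp (f := fun x => ENNReal.ofReal x ^ p)
            (by fun_prop)]
    _ ≤ ENNReal.ofReal (Fintype.card m : ℝ)⁻¹ ^ p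
          * (ENNReal.ofReal (Real.exp (2 * p ^ 2 / (Fintype.card m / 2)))
            * ENNReal.ofReal (Fintype.card m / 2 / (1 / 2)) ^ p) := by
        gcongr
        exact lintegral_rpow_gammaMeasure_le_exp (by norm_num) hp (by linarith)
    _ = ENNReal.ofReal (Real.exp (4 * p ^ 2 / Fintype.card m)) := by
        have hexp : 2 * p ^ 2 / (Fintype.card m / 2 : ℝ) = 4 * p ^ 2 / Fintype.card m := by ring
        have hone : (Fintype.card m : ℝ)⁻¹ * (Fintype.card m / 2 / (1 / 2)) = 1 := by field_simp
        rw [mul_left_comm, ← mul_rpow_of_ne_zero_of_ne_top hm₀ ENNReal.ofReal_ne_top,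
          ← ENNReal.ofReal_mul (inv_nonneg.mpr hm.le), hone, hexp, ENNReal.ofReal_one,
          ENNReal.one_rpow, mul_one]

theorem IsGaussianEmbedding.lintegral_rpow_sum_mulVec_sq_le {Ω : Type*} {m n : Type v}
    [MeasurableSpace Ω] {P : Measure Ω} [Fintype m] [Fintype n] [Nonempty m]
    {S : Ω → Matrix m n ℝ} (hS : IsGaussianEmbedding P S) {p : ℝ} (hp : 1 ≤ |p|)
    (hpm : |p| ≤ Fintype.card m / 4) (v : n → ℝ) :
    ∫⁻ ω, ENNReal.ofReal (∑ r, (S ω *ᵥ v) r ^ 2) ^ p ∂P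
      ≤ ENNReal.ofReal (Real.exp (4 * p ^ 2 / Fintype.card m))
        * ENNReal.ofReal (∑ c, v c ^ 2) ^ p := by
  have hnn : 0 ≤ fun c => v c ^ 2 := fun c => sq_nonneg (v c)
  obtain hD | hD := (Fintype.sum_nonneg hnn).eq_or_lt
  · have hv : v = 0 := by
      ext c
      simpa using congrFun ((Fintype.sum_eq_zero_iff_of_nonneg hnn).mp hD.symm) c
    rcases le_abs'.mp hp with hp | hp
    · simp [hv, ENNReal.zero_rpow_of_neg (by linarith : p < 0), ENNReal.mul_top, Real.exp_pos]
    · simp [hv, ENNReal.zero_rpow_of_pos (by linarith : 0 < p)]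
  · obtain ⟨D, hD_eq⟩ : ∃ D, ∑ c, v c ^ 2 = D := ⟨_, rfl⟩
    rw [hD_eq] at hD ⊢
    have hunit : ∑ c, ((√D)⁻¹ • v) c ^ 2 = 1 := by
      simp [mul_pow, Real.sq_sqrt hD.le, ← Finset.mul_sum, hD_eq, hD.ne']
    have hscale : ∀ ω, ∑ r, (S ω *ᵥ v) r ^ 2 = D * ∑ r, (S ω *ᵥ (√D)⁻¹ • v) r ^ 2 := fun ω => by
      simp [Matrix.mulVec_smul, mul_pow, Real.sq_sqrt hD.le, ← Finset.mul_sum, hD.ne']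
    have hD₀ : ENNReal.ofReal D ≠ 0 := by simpa using hD
    simp_rw [hscale, ENNReal.ofReal_mul hD.le,
      mul_rpow_of_ne_zero_of_ne_top hD₀ ENNReal.ofReal_ne_top]
    rw [lintegral_const_mul' _ _ (ENNReal.rpow_ne_top_of_ne_zero hD₀ ENNReal.ofReal_ne_top),
      mul_comm]
    gcongr
    exact hS.lintegral_rpow_sum_mulVec_sq_le_of_sum_sq_eq_one hp hpm hunit

/-! ### Moments of sums -/

theorem rpow_le_rpow_of_le_of_nonpos {a b : ENNReal} {p : ℝ} (hab : a ≤ b) (hp : p ≤ 0) :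
    b ^ p ≤ a ^ p := by
  rw [← neg_neg p, ENNReal.rpow_neg b, ENNReal.rpow_neg a, ENNReal.inv_le_inv]
  exact ENNReal.rpow_le_rpow hab (by linarith)

section Minkowski

variable {κ : Type*} [Fintype κ] {p : ℝ}

theorem rpow_sum_mul_le_sum_mul_rpow_of_neg {w : κ → ENNReal} (hw₀ : ∀ k, w k ≠ 0)
    (hw : ∑ k, w k = 1) (a : κ → ENNReal) (hp : p < 0) :
    (∑ k, w k * a k) ^ p ≤ ∑ k, w k * a k ^ p := by
  by_cases ha₀ : ∃ k, a k = 0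
  · obtain ⟨k, hk⟩ := ha₀
    have : ∑ k, w k * a k ^ p = ⊤ := ENNReal.sum_eq_top.mpr
      ⟨k, Finset.mem_univ k, by rw [hk, ENNReal.zero_rpow_of_neg hp, ENNReal.mul_top (hw₀ k)]⟩
    exact this ▸ le_top
  by_cases ha : ∃ k, a k = ⊤
  · obtain ⟨k, hk⟩ := ha
    have : ∑ k, w k * a k = ⊤ := ENNReal.sum_eq_top.mpr
      ⟨k, Finset.mem_univ k, by rw [hk, ENNReal.mul_top (hw₀ k)]⟩
    simp [this, ENNReal.top_rpow_of_neg hp]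
  push Not at ha₀ ha
  have hw_top : ∀ k, w k ≠ ⊤ := fun k =>
    ne_top_of_le_ne_top ENNReal.one_ne_top (hw ▸ Finset.single_le_sum (by simp) (Finset.mem_univ k))
  lift w to κ → NNReal using hw_top
  lift a to κ → NNReal using ha
  beta_reduce at hw ha₀ ⊢
  replace hw : ∑ k, w k = 1 := by exact_mod_cast hw
  replace ha₀ : ∀ k, a k ≠ 0 := fun k => by exact_mod_cast ha₀ k
  have hprod : ∏ k, a k ^ (w k : ℝ) ≤ ∑ k, w k * a k :=
    NNReal.geom_mean_le_arith_mean_weighted _ w a hw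
  have hprod_pos : 0 < ∏ k, a k ^ (w k : ℝ) :=
    Finset.prod_pos fun k _ => NNReal.rpow_pos (pos_iff_ne_zero.mpr (ha₀ k))
  have hreal : (∑ k, w k * a k) ^ p ≤ ∑ k, w k * a k ^ p :=
    calc (∑ k, w k * a k) ^ p ≤ (∏ k, a k ^ (w k : ℝ)) ^ p :=
          NNReal.rpow_le_rpow_of_nonpos hprod_pos hprod hp.le
      _ = ∏ k, (a k ^ p) ^ (w k : ℝ) := by
          simp_rw [← NNReal.finsetProd_rpow, ← NNReal.rpow_mul, mul_comm]
      _ ≤ ∑ k, w k * a k ^ p := NNReal.geom_mean_le_arith_mean_weighted _ w _ hw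
  have hsum : ∑ k, w k * a k ≠ 0 := (hprod_pos.trans_le hprod).ne'
  simp_rw [← ENNReal.coe_rpow_of_ne_zero (ha₀ _), ← ENNReal.coe_mul, ← ENNReal.ofNNReal_finsetSum,
    ← ENNReal.coe_rpow_of_ne_zero hsum]
  exact_mod_cast hreal

variable {Ω : Type*} [MeasurableSpace Ω] {P : Measure Ω} {Y : κ → Ω → ENNReal} {d : κ → ENNReal}
  {K : ENNReal}

theorem lintegral_rpow_sum_le_of_one_le (hp : 1 ≤ p) (hY : ∀ k, AEMeasurable (Y k) P)
    (h : ∀ k, ∫⁻ ω, Y k ω ^ p ∂P ≤ K * d k ^ p) :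
    ∫⁻ ω, (∑ k, Y k ω) ^ p ∂P ≤ K * (∑ k, d k) ^ p := by
  have hp₀ : 0 < p := by linarith
  have hnorm : ∀ k, (∫⁻ ω, Y k ω ^ p ∂P) ^ (1 / p) ≤ K ^ (1 / p) * d k := fun k => by
    refine (ENNReal.rpow_le_rpow (h k) (by positivity)).trans_eq ?_
    rw [ENNReal.mul_rpow_of_nonneg _ _ (by positivity), ← ENNReal.rpow_mul,
      mul_one_div_cancel hp₀.ne', ENNReal.rpow_one]
  rw [← ENNReal.rpow_le_rpow_iff (z := 1 / p) (by positivity),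
    ENNReal.mul_rpow_of_nonneg _ _ (by positivity), ← ENNReal.rpow_mul,
    mul_one_div_cancel hp₀.ne', ENNReal.rpow_one, Finset.mul_sum]
  calc (∫⁻ ω, (∑ k, Y k ω) ^ p ∂P) ^ (1 / p)
      ≤ ∑ k, (∫⁻ ω, Y k ω ^ p ∂P) ^ (1 / p) := by
        simpa [eLpNorm'] using
          eLpNorm'_sum_le (s := Finset.univ) (fun k _ => (hY k).aestronglyMeasurable) hp
    _ ≤ ∑ k, K ^ (1 / p) * d k := Finset.sum_le_sum fun k _ => hnorm k

/-- Since `·ᵖ` is convex and homogeneous, Jensen's inequality with the weights `d k / ∑ k, d k`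
plays the role of Minkowski's inequality for negative exponents. -/
theorem lintegral_rpow_sum_le_of_neg_of_ne_zero [Nonempty κ] (hp : p < 0)
    (hY : ∀ k, AEMeasurable (Y k) P) (hd₀ : ∀ k, d k ≠ 0) (hd : ∀ k, d k ≠ ⊤)
    (h : ∀ k, ∫⁻ ω, Y k ω ^ p ∂P ≤ K * d k ^ p) :
    ∫⁻ ω, (∑ k, Y k ω) ^ p ∂P ≤ K * (∑ k, d k) ^ p := by
  obtain ⟨D, hD⟩ : ∃ D, ∑ k, d k = D := ⟨_, rfl⟩
  have hD₀ : D ≠ 0 := by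
    simpa [← hD] using ⟨Classical.arbitrary κ, hd₀ _⟩
  have hD_top : D ≠ ⊤ := by simpa [← hD] using hd
  have hsplit : ∀ ω, ∑ k, Y k ω = D * ∑ k, d k / D * ((d k)⁻¹ * Y k ω) := fun ω => by
    rw [Finset.mul_sum]
    refine Finset.sum_congr rfl fun k _ => ?_
    rw [← mul_assoc, ENNReal.mul_div_cancel hD₀ hD_top, ← mul_assoc,
      ENNReal.mul_inv_cancel (hd₀ k) (hd k), one_mul]
  have hw : ∑ k, d k / D = 1 := by
    simp_rw [div_eq_mul_inv, ← Finset.sum_mul, hD, ENNReal.mul_inv_cancel hD₀ hD_top]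
  have hw₀ : ∀ k, d k / D ≠ 0 := fun k => ENNReal.div_ne_zero.mpr ⟨hd₀ k, hD_top⟩
  have hterm : ∀ k, ∫⁻ ω, ((d k)⁻¹ * Y k ω) ^ p ∂P ≤ K := fun k => by
    have hinv₀ : (d k)⁻¹ ≠ 0 := ENNReal.inv_ne_zero.mpr (hd k)
    have hinv : (d k)⁻¹ ≠ ⊤ := ENNReal.inv_ne_top.mpr (hd₀ k)
    simp_rw [mul_rpow_of_ne_zero_of_ne_top hinv₀ hinv]
    rw [lintegral_const_mul' _ _ (ENNReal.rpow_ne_top_of_ne_zero hinv₀ hinv)]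
    refine (mul_le_mul_right (h k) _).trans_eq ?_
    rw [mul_left_comm, ← mul_rpow_of_ne_zero_of_ne_top hinv₀ hinv,
      ENNReal.inv_mul_cancel (hd₀ k) (hd k), ENNReal.one_rpow, mul_one]
  rw [hD]
  calc ∫⁻ ω, (∑ k, Y k ω) ^ p ∂P
      ≤ ∫⁻ ω, D ^ p * ∑ k, d k / D * ((d k)⁻¹ * Y k ω) ^ p ∂P := by
        refine lintegral_mono fun ω => ?_
        rw [hsplit, mul_rpow_of_ne_zero_of_ne_top hD₀ hD_top]
        gcongr
        exact rpow_sum_mul_le_sum_mul_rpow_of_neg hw₀ hw _ hp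
    _ = D ^ p * ∑ k, d k / D * ∫⁻ ω, ((d k)⁻¹ * Y k ω) ^ p ∂P := by
        rw [lintegral_const_mul' _ _ (ENNReal.rpow_ne_top_of_ne_zero hD₀ hD_top),
          lintegral_finsetSum' _ fun k _ => by fun_prop]
        simp_rw [lintegral_const_mul' _ _ (ENNReal.div_ne_top (hd _) hD₀)]
    _ ≤ D ^ p * ∑ k, d k / D * K := by gcongr with k; exact hterm k
    _ = K * D ^ p := by rw [← Finset.sum_mul, hw, one_mul, mul_comm]

theorem lintegral_rpow_sum_le_of_neg (hp : p < 0) (hK : K ≠ 0)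
    (hY : ∀ k, AEMeasurable (Y k) P) (hd : ∀ k, d k ≠ ⊤)
    (h : ∀ k, ∫⁻ ω, Y k ω ^ p ∂P ≤ K * d k ^ p) :
    ∫⁻ ω, (∑ k, Y k ω) ^ p ∂P ≤ K * (∑ k, d k) ^ p := by
  classical
  have hsupp : ∑ k : {k // d k ≠ 0}, d k = ∑ k, d k := by
    rw [← Finset.sum_subtype (Finset.univ.filter (d · ≠ 0)) (by simp) d, Finset.sum_filter_ne_zero]
  rcases isEmpty_or_nonempty {k // d k ≠ 0} with hempty | hne
  · rw [← hsupp, Fintype.sum_empty, ENNReal.zero_rpow_of_neg hp, ENNReal.mul_top hK]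
    exact le_top
  · refine le_trans (lintegral_mono fun ω => ?_) (hsupp ▸
      lintegral_rpow_sum_le_of_neg_of_ne_zero hp (fun k : {k // d k ≠ 0} => hY k) (fun k => k.2)
        (fun k => hd k) fun k => h k)
    refine rpow_le_rpow_of_le_of_nonpos ?_ hp.le
    rw [← Finset.sum_subtype (Finset.univ.filter (d · ≠ 0)) (by simp) fun k => Y k ω]
    exact Finset.sum_le_univ_sum_of_nonneg fun k => zero_le

theorem lintegral_rpow_sum_le (hp : 1 ≤ |p|) (hK : K ≠ 0)
    (hY : ∀ k, AEMeasurable (Y k) P) (hd : ∀ k, d k ≠ ⊤)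
    (h : ∀ k, ∫⁻ ω, Y k ω ^ p ∂P ≤ K * d k ^ p) :
    ∫⁻ ω, (∑ k, Y k ω) ^ p ∂P ≤ K * (∑ k, d k) ^ p := by
  rcases le_abs'.mp hp with hp | hp
  · exact lintegral_rpow_sum_le_of_neg (by linarith) hK hY hd h
  · exact lintegral_rpow_sum_le_of_one_le hp hY h

end Minkowski

/-! ### Summation over some of the coordinates -/

section SumOut

variable {ι R : Type*} [DecidableEq ι] {π : ι → Type*}

theorem apply_updateFinset_of_dependsOn {β : Type*} {g : (∀ i, π i) → β} {F : Finset ι}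
    (hg : DependsOn g (F : Set ι)ᶜ) (x : ∀ i, π i) (y : ∀ i : F, π i) :
    g (Function.updateFinset x F y) = g x :=
  hg fun _ hi => dif_neg hi

variable [∀ i, Fintype (π i)]

/-- The sum of `h` over the coordinates in `F`, as a function of the same variables as `h` that no
longer depends on the coordinates in `F`: the finite analogue of `MeasureTheory.lmarginal`, used
for the contraction of tensors along the edges in `F`. -/
def sumOut [AddCommMonoid R] (F : Finset ι) (h : (∀ i, π i) → R) (x : ∀ i, π i) : R :=
  ∑ y : ∀ i : F, π i, h (Function.updateFinset x F y)

theorem sumOut_empty [AddCommMonoid R] (h : (∀ i, π i) → R) : sumOut ∅ h = h :=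
  funext fun _ => Fintype.sum_unique _

theorem sumOut_univ [AddCommMonoid R] [Fintype ι] (h : (∀ i, π i) → R) (x : ∀ i, π i) :
    sumOut Finset.univ h x = ∑ y, h y :=
  Finset.sum_nbij' (Function.updateFinset x Finset.univ)
    Finset.univ.restrict (by simp) (by simp) (fun y _ => Function.restrict_updateFinset x y)
    (by simp [Function.updateFinset_univ]) (by simp)

theorem sumOut_union [AddCommMonoid R] {F F' : Finset ι} (hF : Disjoint F F')
    (h : (∀ i, π i) → R) : sumOut (F ∪ F') h = sumOut F (sumOut F' h) := by
  ext x
  simp only [sumOut, Function.updateFinset_updateFinset hF, ← Fintype.sum_prod_type']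
  exact (Fintype.sum_equiv (Equiv.piFinsetUnion π hF) _ _ fun _ => rfl).symm

theorem dependsOn_sumOut [AddCommMonoid R] {h : (∀ i, π i) → R} {s : Set ι} (hh : DependsOn h s)
    (F : Finset ι) : DependsOn (sumOut F h) (s \ F) := fun _ _ hxy =>
  Finset.sum_congr rfl fun y _ => hh.updateFinset y hxy

theorem sumOut_mul_of_dependsOn [NonUnitalNonAssocSemiring R] {F : Finset ι}
    {g : (∀ i, π i) → R} (hg : DependsOn g (F : Set ι)ᶜ) (h : (∀ i, π i) → R) :
    sumOut F (fun y => g y * h y) = fun x => g x * sumOut F h x := by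
  ext x
  simp only [sumOut, apply_updateFinset_of_dependsOn hg, Finset.mul_sum]

theorem sumOut_of_dependsOn [AddCommMonoid R] {F : Finset ι} {g : (∀ i, π i) → R}
    (hg : DependsOn g (F : Set ι)ᶜ) :
    sumOut F g = fun x => Fintype.card (∀ i : F, π i) • g x := by
  ext x
  simp only [sumOut, apply_updateFinset_of_dependsOn hg, Finset.sum_const, Finset.card_univ]

theorem sum_sumOut [AddCommMonoid R] [Fintype ι] (F : Finset ι) (h : (∀ i, π i) → R) :
    ∑ x, sumOut F h x = Fintype.card (∀ i : F, π i) • ∑ x, h x := by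
  rcases isEmpty_or_nonempty (∀ i, π i) with hempty | ⟨⟨x₀⟩⟩
  · simp
  have hidem : sumOut F (sumOut F h) = fun x => Fintype.card (∀ i : F, π i) • sumOut F h x :=
    sumOut_of_dependsOn <| (dependsOn_sumOut (dependsOn_univ h) F).mono fun _ hi => hi.2
  have hsplit : ∀ k : (∀ i, π i) → R, ∑ x, k x = sumOut Fᶜ (sumOut F k) x₀ := fun k => by
    rw [← sumOut_univ k x₀, ← sumOut_union disjoint_compl_left, Finset.union_comm,
      Finset.union_compl]
  rw [hsplit, hidem, hsplit h]
  exact Finset.sum_nsmul _ _ _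

theorem sumOut_eq_sum_ite [AddCommMonoid R] [Fintype ι] [∀ i, DecidableEq (π i)] (F : Finset ι)
    (h : (∀ i, π i) → R) (x : ∀ i, π i) :
    sumOut F h x = ∑ y, if ∀ i ∉ F, y i = x i then h y else 0 := by
  rw [← Finset.sum_filter]
  refine Finset.sum_nbij' (Function.updateFinset x F) F.restrict ?_ (by simp)
    (fun y _ => Function.restrict_updateFinset x y) (fun y hy => ?_) fun _ _ => rfl
  · simp +contextual [Function.updateFinset]
  · ext i
    by_cases hi : i ∈ F <;> simp_all [Function.updateFinset]

theorem card_mul_sum_restrict [Semiring R] [Fintype ι] (F : Finset ι) (h : (∀ i : F, π i) → R) :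
    Fintype.card (∀ i : F, π i) * ∑ x : ∀ i, π i, h (F.restrict x)
      = Fintype.card (∀ i, π i) * ∑ y, h y := by
  simp only [← nsmul_eq_mul, ← sum_sumOut F]
  simp only [sumOut, Function.restrict_updateFinset, Finset.sum_const, Finset.card_univ]

end SumOut

/-! ### Contraction along a linearization -/

namespace EmbeddingNetwork

variable {V : Type u} {E : Type v}

theorem ends_nonempty (G : EmbeddingNetwork V E) (e : E) : (G.ends e).Nonempty := by
  rw [← Finset.card_pos]
  have := G.card_ends e
  omega

theorem card_idx [DecidableEq E] (G : EmbeddingNetwork V E) (F : Finset E) :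
    Fintype.card (G.Idx F) = ∏ e ∈ F, G.dim e := by
  simp only [Fintype.card_pi, Fintype.card_fin]
  exact Finset.prod_coe_sort F G.dim

theorem mem_incident [DecidableEq V] [Fintype E] {G : EmbeddingNetwork V E} {a : V} {e : E} :
    e ∈ G.incident a ↔ a ∈ G.ends e := by
  simp [incident]

theorem mem_output [Fintype E] [DecidableEq E] {G : EmbeddingNetwork V E} {e : E} :
    e ∈ G.output ↔ (G.ends e).card = 1 ∧ e ∉ G.input := by
  simp [output]

instance (G : EmbeddingNetwork V E) (F : Finset E) : Nonempty (G.Idx F) :=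
  ⟨fun e => ⟨0, G.dim_pos e⟩⟩

instance (G : EmbeddingNetwork V E) : Nonempty (∀ e, Fin (G.dim e)) :=
  ⟨fun e => ⟨0, G.dim_pos e⟩⟩

variable [Fintype V] [DecidableEq V] [Fintype E] [DecidableEq E]

section Edges

variable {G : EmbeddingNetwork V E} {σ : G.Linearization} {a b : V} {e : E}

theorem mem_rowEdges :
    e ∈ G.rowEdges σ a ↔ a ∈ G.ends e ∧ (e ∈ G.output ∨ ∃ b ∈ G.ends e, σ a < σ b) := by
  simp [rowEdges, mem_incident]

theorem mem_colEdges :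
    e ∈ G.colEdges σ a ↔ a ∈ G.ends e ∧ e ∉ G.output ∧ ∀ b ∈ G.ends e, σ b ≤ σ a := by
  rw [colEdges, Finset.mem_sdiff, mem_rowEdges, mem_incident]
  push Not
  tauto

theorem notMem_incident_of_mem_colEdges (hab : σ b < σ a) (he : e ∈ G.colEdges σ b) :
    e ∉ G.incident a := fun ha =>
  hab.not_ge ((mem_colEdges.mp he).2.2 a (mem_incident.mp ha))

theorem notMem_incident_of_mem_rowEdges (hab : σ b < σ a) (he : e ∈ G.rowEdges σ a) :
    e ∉ G.incident b := by
  intro hb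
  rw [mem_incident] at hb
  obtain ⟨ha, ho | ⟨d, hd, had⟩⟩ := mem_rowEdges.mp he
  · exact hab.ne (congrArg σ (Finset.card_le_one.mp (mem_output.mp ho).1.le b hb a ha))
  · have : 2 < (G.ends e).card := Finset.two_lt_card.mpr ⟨b, hb, a, ha, d, hd,
      ne_of_apply_ne σ hab.ne, ne_of_apply_ne σ (hab.trans had).ne, ne_of_apply_ne σ had.ne⟩
    have := G.card_ends e
    omega

theorem notMem_input_of_mem_rowEdges (he : e ∈ G.rowEdges σ a) : e ∉ G.input := by
  intro hi
  obtain ⟨ha, ho | ⟨d, hd, had⟩⟩ := mem_rowEdges.mp he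
  · exact (mem_output.mp ho).2 hi
  · exact had.ne (congrArg σ
      (Finset.card_le_one.mp (G.input_uncontracted e hi).le a ha d hd))

variable (G σ) in
theorem biUnion_colEdges : Finset.univ.biUnion (G.colEdges σ) = G.outputᶜ := by
  ext e
  simp only [Finset.mem_biUnion, Finset.mem_univ, true_and, Finset.mem_compl]
  refine ⟨fun ⟨a, ha⟩ => (mem_colEdges.mp ha).2.1, fun he => ?_⟩
  obtain ⟨a, ha, hmax⟩ := (G.ends e).exists_max_image σ (G.ends_nonempty e)
  exact ⟨a, mem_colEdges.mpr ⟨ha, he, hmax⟩⟩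

variable (G σ) in
theorem biUnion_rowEdges : Finset.univ.biUnion (G.rowEdges σ) = G.inputᶜ := by
  ext e
  simp only [Finset.mem_biUnion, Finset.mem_univ, true_and, Finset.mem_compl]
  refine ⟨fun ⟨a, ha⟩ => notMem_input_of_mem_rowEdges ha, fun he => ?_⟩
  obtain ⟨a, ha, hmin⟩ := (G.ends e).exists_min_image σ (G.ends_nonempty e)
  refine ⟨a, mem_rowEdges.mpr ⟨ha, ?_⟩⟩
  rcases G.card_ends e with h | h
  · exact .inl (mem_output.mpr ⟨h, he⟩)
  · obtain ⟨b, hb, hba⟩ := Finset.exists_mem_ne (by omega : 1 < (G.ends e).card) a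
    exact .inr ⟨b, hb, (hmin b hb).lt_of_ne (σ.injective.ne hba.symm)⟩

variable (G σ) in
theorem pairwiseDisjoint_colEdges (s : Set V) : s.PairwiseDisjoint (G.colEdges σ) := by
  refine fun a _ b _ hab => Finset.disjoint_left.mpr fun e ha hb => ?_
  rcases (σ.injective.ne hab).lt_or_gt with h | h
  · exact notMem_incident_of_mem_colEdges h ha (Finset.sdiff_subset hb)
  · exact notMem_incident_of_mem_colEdges h hb (Finset.sdiff_subset ha)

variable (G σ) in
theorem pairwiseDisjoint_rowEdges (s : Set V) : s.PairwiseDisjoint (G.rowEdges σ) := by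
  refine fun a _ b _ hab => Finset.disjoint_left.mpr fun e ha hb => ?_
  rcases (σ.injective.ne hab).lt_or_gt with h | h
  · exact notMem_incident_of_mem_rowEdges h hb (Finset.filter_subset _ _ ha)
  · exact notMem_incident_of_mem_rowEdges h ha (Finset.filter_subset _ _ hb)

end Edges

section Sizes

variable (G : EmbeddingNetwork V E)

/-- The number of columns of the matricized tensor at the vertex `a`, the counterpart of
`EmbeddingNetwork.rowSize`. -/
def colSize (σ : G.Linearization) (a : V) : ℕ := Fintype.card (G.Idx (G.colEdges σ a))

theorem rowSize_pos (σ : G.Linearization) (a : V) : 0 < G.rowSize σ a := Fintype.card_pos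

theorem colSize_pos (σ : G.Linearization) (a : V) : 0 < G.colSize σ a := Fintype.card_pos

theorem card_input_mul_prod_rowSize (σ : G.Linearization) :
    Fintype.card (G.Idx G.input) * ∏ a, G.rowSize σ a = Fintype.card (∀ e, Fin (G.dim e)) := by
  simp only [rowSize, card_idx]
  rw [← Finset.prod_biUnion (G.pairwiseDisjoint_rowEdges σ _), biUnion_rowEdges,
    Finset.prod_mul_prod_compl, Fintype.card_pi]
  simp only [Fintype.card_fin]

theorem card_output_mul_prod_colSize (σ : G.Linearization) :
    Fintype.card (G.Idx G.output) * ∏ a, G.colSize σ a = Fintype.card (∀ e, Fin (G.dim e)) := by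
  simp only [colSize, card_idx]
  rw [← Finset.prod_biUnion (G.pairwiseDisjoint_colEdges σ _), biUnion_colEdges,
    Finset.prod_mul_prod_compl, Fintype.card_pi]
  simp only [Fintype.card_fin]

end Sizes

section PartialSketch

variable (G : EmbeddingNetwork V E) (σ : G.Linearization)

/-- The tensor obtained from the data tensor `u` by contraction with the tensors at the vertices in
`s`, as a function of an index for every edge of the network. If `s` is an initial segment of the
linearization, this is the state of the sketch after the vertices in `s` have been applied. -/
def partialSketch (u : G.Idx G.input → ℝ) (T : (a : V) → G.Core a) (s : Finset V) :
    (∀ e, Fin (G.dim e)) → ℝ :=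
  sumOut (s.biUnion (G.colEdges σ)) fun x =>
    (∏ a ∈ s, T a ((G.incident a).restrict x)) * u (G.input.restrict x)

theorem partialSketch_empty (u : G.Idx G.input → ℝ) (T : (a : V) → G.Core a) :
    G.partialSketch σ u T ∅ = fun x => u (G.input.restrict x) := by
  simp [partialSketch, sumOut_empty]

theorem partialSketch_univ (u : G.Idx G.input → ℝ) (T : (a : V) → G.Core a)
    (x : ∀ e, Fin (G.dim e)) :
    G.partialSketch σ u T Finset.univ x = (G.embedding T *ᵥ u) (G.output.restrict x) := by
  simp only [partialSketch, biUnion_colEdges, sumOut_eq_sum_ite, Matrix.mulVec, dotProduct,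
    embedding, Matrix.of_apply, Finset.sum_mul]
  rw [Finset.sum_comm]
  refine Finset.sum_congr rfl fun y _ => ?_
  rw [Finset.sum_eq_single (G.input.restrict y)]
  · simp only [Finset.mem_compl, not_not, Finset.restrict, Subtype.forall, implies_true, and_true,
      ite_mul, zero_mul]
    rfl
  · intro c _ hc
    rw [if_neg fun h => hc (funext fun e => (h.2 e).symm), zero_mul]
  · simp

variable {G σ} {a : V} {s : Finset V}

theorem partialSketch_insert (hs : ∀ b ∈ s, σ b < σ a) (u : G.Idx G.input → ℝ)
    (T : (a : V) → G.Core a) :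
    G.partialSketch σ u T (insert a s) = sumOut (G.colEdges σ a) fun x =>
      T a ((G.incident a).restrict x) * G.partialSketch σ u T s x := by
  have ha : a ∉ s := fun ha => (hs a ha).false
  have hdisj : Disjoint (G.colEdges σ a) (s.biUnion (G.colEdges σ)) :=
    (Finset.disjoint_biUnion_right _ _ _).mpr fun b hb =>
      G.pairwiseDisjoint_colEdges σ Set.univ trivial trivial (ne_of_mem_of_not_mem hb ha).symm
  have hcore : DependsOn (fun x : ∀ e, Fin (G.dim e) => T a ((G.incident a).restrict x))
      (s.biUnion (G.colEdges σ) : Set E)ᶜ := fun x y hxy => by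
    refine congrArg (T a) (Finset.dependsOn_restrict _ fun e he => hxy e fun hcol => ?_)
    obtain ⟨b, hb, heb⟩ := Finset.mem_biUnion.mp hcol
    exact notMem_incident_of_mem_colEdges (hs b hb) heb he
  simp only [partialSketch, Finset.biUnion_insert, sumOut_union hdisj, Finset.prod_insert ha,
    mul_assoc, sumOut_mul_of_dependsOn hcore]

theorem dependsOn_partialSketch (hs : ∀ b ∈ s, σ b < σ a) (u : G.Idx G.input → ℝ)
    (T : (a : V) → G.Core a) :
    DependsOn (G.partialSketch σ u T s) (G.rowEdges σ a : Set E)ᶜ := by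
  refine (dependsOn_sumOut (s := (G.rowEdges σ a : Set E)ᶜ) (fun x y hxy => ?_) _).mono
    Set.sdiff_subset
  have hinput : G.input.restrict x = G.input.restrict y :=
    Finset.dependsOn_restrict _ fun e he => hxy e fun hrow => notMem_input_of_mem_rowEdges hrow he
  have hcore : ∀ b ∈ s, (G.incident b).restrict x = (G.incident b).restrict y := fun b hb =>
    Finset.dependsOn_restrict _ fun e he => hxy e fun hrow =>
      notMem_incident_of_mem_rowEdges (hs b hb) hrow he
  rw [hinput, Finset.prod_congr rfl fun b hb => by rw [hcore b hb]]

theorem partialSketch_congr (u : G.Idx G.input → ℝ) {T T' : (a : V) → G.Core a}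
    (hT : ∀ a ∈ s, T a = T' a) : G.partialSketch σ u T s = G.partialSketch σ u T' s := by
  unfold partialSketch
  congr! 3 with x
  exact Finset.prod_congr rfl fun a ha => by rw [hT a ha]

theorem sumOut_colEdges_updateFinset (t : G.Core a) {f : (∀ e, Fin (G.dim e)) → ℝ}
    (hf : DependsOn f (G.rowEdges σ a : Set E)ᶜ) (x : ∀ e, Fin (G.dim e))
    (r : G.Idx (G.rowEdges σ a)) :
    sumOut (G.colEdges σ a) (fun x => t ((G.incident a).restrict x) * f x)
        (Function.updateFinset x (G.rowEdges σ a) r)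
      = (G.coreMatrix σ a t *ᵥ fun c => f (Function.updateFinset x (G.colEdges σ a) c)) r := by
  refine Finset.sum_congr rfl fun c _ => ?_
  refine congrArg₂ (· * ·) ?_ ?_
  · simp only [coreMatrix, Matrix.of_apply]
    congr 1
    ext e
    by_cases he : (e : E) ∈ G.rowEdges σ a <;>
      simp [Function.updateFinset, colEdges, he]
  · exact hf fun e he => by grind [Function.updateFinset]

end PartialSketch

end EmbeddingNetwork

theorem lintegral_eq_lintegral_lintegral_of_indepFun {Ω α β : Type*} [MeasurableSpace Ω]
    [MeasurableSpace α] [MeasurableSpace β] {P : Measure Ω} [IsFiniteMeasure P] {X : Ω → α}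
    {Y : Ω → β} (hX : AEMeasurable X P) (hY : AEMeasurable Y P) (hXY : IndepFun X Y P)
    {f : α → β → ENNReal} (hf : Measurable (Function.uncurry f)) :
    ∫⁻ ω, f (X ω) (Y ω) ∂P = ∫⁻ ω, ∫⁻ ω', f (X ω) (Y ω') ∂P ∂P := by
  calc ∫⁻ ω, f (X ω) (Y ω) ∂P
      = ∫⁻ z, Function.uncurry f z ∂(P.map fun ω => (X ω, Y ω)) :=
        (lintegral_map' hf.aemeasurable (hX.prodMk hY)).symm
    _ = ∫⁻ x, ∫⁻ y, f x y ∂(P.map Y) ∂(P.map X) := by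
        rw [hXY.map_prod_eq_prod_map_map hX hY, lintegral_prod _ hf.aemeasurable]
        rfl
    _ = ∫⁻ ω, ∫⁻ y, f (X ω) y ∂(P.map Y) ∂P :=
        lintegral_map' hf.lintegral_prod_right.aemeasurable hX
    _ = ∫⁻ ω, ∫⁻ ω', f (X ω) (Y ω') ∂P ∂P := by
        congr! 2 with ω
        exact lintegral_map' hf.of_uncurry_left.aemeasurable hY

theorem indepFun_of_dependsOn {Ω ι γ : Type*} {β : ι → Type*} [MeasurableSpace Ω]
    [∀ i, MeasurableSpace (β i)] [MeasurableSpace γ] {P : Measure Ω} {X : ∀ i, Ω → β i}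
    (hX : ∀ i, AEMeasurable (X i) P) (hind : iIndepFun X P) {g : (∀ i, β i) → γ}
    (hg : Measurable g) {s : Finset ι} (hgs : DependsOn g s) {i : ι} (hi : i ∉ s) :
    IndepFun (fun ω => g fun j => X j ω) (X i) P := by
  classical
  have := hind.isProbabilityMeasure
  obtain ⟨ω₀⟩ := P.nonempty_of_neZero
  have hind' := (hind.indepFun_finset₀ s {i} (Finset.disjoint_singleton_right.mpr hi) hX).comp
    (hg.comp (measurable_updateFinset (x := fun j => X j ω₀)))
    (measurable_pi_apply (⟨i, Finset.mem_singleton_self i⟩ : ({i} : Finset ι)))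
  have hgX : (fun ω => g fun j => X j ω) =
      fun ω => g (Function.updateFinset (fun j => X j ω₀) s fun j => X j ω) := by
    ext ω
    exact hgs fun j hj => by simp [Function.updateFinset, Finset.mem_coe.mp hj]
  exact hgX ▸ hind'

theorem IsGaussianEmbedding.aemeasurable_apply {Ω : Type*} {m n : Type v} [MeasurableSpace Ω]
    {P : Measure Ω} [Fintype m] {S : Ω → Matrix m n ℝ} (hS : IsGaussianEmbedding P S) (r : m)
    (c : n) : AEMeasurable (fun ω => S ω r c) P := by
  obtain ⟨M, hM, -, hSM⟩ := hS
  simp only [hSM]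
  exact (hM _).aemeasurable.const_mul _

theorem IsGaussianEmbedding.aemeasurable_sum_mulVec_sq {Ω : Type*} {m n : Type v}
    [MeasurableSpace Ω] {P : Measure Ω} [Fintype m] [Fintype n] {S : Ω → Matrix m n ℝ}
    (hS : IsGaussianEmbedding P S) (v : n → ℝ) :
    AEMeasurable (fun ω => ∑ r, (S ω *ᵥ v) r ^ 2) P :=
  Finset.aemeasurable_fun_sum _ fun r _ => (Finset.aemeasurable_fun_sum _ fun c _ =>
    (hS.aemeasurable_apply r c).mul_const _).pow_const _

namespace EmbeddingNetwork

variable {V : Type u} {E : Type v} [Fintype V] [DecidableEq V] [Fintype E] [DecidableEq E]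
  {G : EmbeddingNetwork V E} {σ : G.Linearization} {a : V}

theorem rowSize_mul_sum_sq_sumOut_colEdges (t : G.Core a) {f : (∀ e, Fin (G.dim e)) → ℝ}
    (hf : DependsOn f (G.rowEdges σ a : Set E)ᶜ) :
    G.rowSize σ a * ∑ x,
        sumOut (G.colEdges σ a) (fun x => t ((G.incident a).restrict x) * f x) x ^ 2
      = ∑ x, ∑ r, (G.coreMatrix σ a t *ᵥ
          fun c => f (Function.updateFinset x (G.colEdges σ a) c)) r ^ 2 := by
  simp only [← sumOut_colEdges_updateFinset t hf]
  rw [rowSize, ← nsmul_eq_mul, ← sum_sumOut (π := fun e => Fin (G.dim e))]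
  rfl

theorem lintegral_rpow_rowSize_mul_sum_sq_le {Ω : Type*} [MeasurableSpace Ω] {P : Measure Ω}
    {A : Ω → G.Core a} (hA : IsGaussianEmbedding P fun ω => G.coreMatrix σ a (A ω)) {p : ℝ}
    (hp : 1 ≤ |p|) (hpa : |p| ≤ G.rowSize σ a / 4) {f : (∀ e, Fin (G.dim e)) → ℝ}
    (hf : DependsOn f (G.rowEdges σ a : Set E)ᶜ) :
    ∫⁻ ω, ENNReal.ofReal (G.rowSize σ a * ∑ x,
        sumOut (G.colEdges σ a) (fun x => A ω ((G.incident a).restrict x) * f x) x ^ 2) ^ p ∂P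
      ≤ ENNReal.ofReal (Real.exp (4 * p ^ 2 / G.rowSize σ a))
        * ENNReal.ofReal (G.colSize σ a * ∑ x, f x ^ 2) ^ p := by
  have hcol : G.colSize σ a * ∑ x, f x ^ 2
      = ∑ x, ∑ c, f (Function.updateFinset x (G.colEdges σ a) c) ^ 2 := by
    rw [colSize, ← nsmul_eq_mul, ← sum_sumOut (π := fun e => Fin (G.dim e))]
    rfl
  simp only [rowSize_mul_sum_sq_sumOut_colEdges _ hf, hcol]
  simp only [ENNReal.ofReal_sum_of_nonneg fun _ _ => Finset.sum_nonneg fun _ _ => sq_nonneg _]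
  exact lintegral_rpow_sum_le hp (by simp [Real.exp_pos])
    (fun x => (hA.aemeasurable_sum_mulVec_sq _).ennreal_ofReal) (fun _ => ENNReal.ofReal_ne_top)
    fun x => hA.lintegral_rpow_sum_mulVec_sq_le hp hpa _

variable (G σ) in
/-- The mean square of the entries of the partial sketch, normalized by the dimensions so that it
interpolates between the squared norm of the data and the squared norm of the full sketch. -/
noncomputable def partialEnergy (u : G.Idx G.input → ℝ) (T : (a : V) → G.Core a)
    (s : Finset V) : ℝ :=
  Fintype.card (G.Idx G.input) * (∏ a ∈ s, (G.rowSize σ a / G.colSize σ a : ℝ))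
    / Fintype.card (∀ e, Fin (G.dim e)) * ∑ x, G.partialSketch σ u T s x ^ 2

variable (σ) in
theorem partialEnergy_empty (u : G.Idx G.input → ℝ) (T : (a : V) → G.Core a) :
    G.partialEnergy σ u T ∅ = ∑ c, u c ^ 2 := by
  have : (Fintype.card (∀ e, Fin (G.dim e)) : ℝ) ≠ 0 := Nat.cast_ne_zero.mpr Fintype.card_ne_zero
  rw [partialEnergy, partialSketch_empty, Finset.prod_empty, mul_one, div_mul_eq_mul_div,
    card_mul_sum_restrict (π := fun e => Fin (G.dim e)) G.input fun c => u c ^ 2,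
    mul_div_cancel_left₀ _ this]

variable (σ) in
theorem partialEnergy_univ (u : G.Idx G.input → ℝ) (T : (a : V) → G.Core a) :
    G.partialEnergy σ u T Finset.univ = ∑ r, (G.embedding T *ᵥ u) r ^ 2 := by
  have hX : (Fintype.card (∀ e, Fin (G.dim e)) : ℝ) ≠ 0 :=
    Nat.cast_ne_zero.mpr Fintype.card_ne_zero
  have hcol : ∏ a, (G.colSize σ a : ℝ) ≠ 0 :=
    Finset.prod_ne_zero_iff.mpr fun a _ => (Nat.cast_pos.mpr (G.colSize_pos σ a)).ne'
  have hsize : Fintype.card (G.Idx G.input) * ∏ a, (G.rowSize σ a / G.colSize σ a : ℝ)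
      = Fintype.card (G.Idx G.output) := by
    rw [Finset.prod_div_distrib, mul_div_assoc', div_eq_iff hcol]
    exact_mod_cast (G.card_input_mul_prod_rowSize σ).trans (G.card_output_mul_prod_colSize σ).symm
  simp only [partialEnergy, partialSketch_univ]
  rw [hsize, div_mul_eq_mul_div,
    card_mul_sum_restrict (π := fun e => Fin (G.dim e)) G.output
      fun r => (G.embedding T *ᵥ u) r ^ 2,
    mul_div_cancel_left₀ _ hX]

theorem measurable_partialSketch (u : G.Idx G.input → ℝ) (s : Finset V) :
    Measurable fun T : (a : V) → G.Core a => G.partialSketch σ u T s := by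
  refine measurable_pi_lambda _ fun x => Finset.measurable_fun_sum _ fun y _ =>
    (Finset.measurable_fun_prod _ fun a _ => ?_).mul_const _
  exact (measurable_pi_apply _).comp (measurable_pi_apply a)

theorem aemeasurable_of_isGaussianEmbedding_coreMatrix {Ω : Type*} [MeasurableSpace Ω]
    {P : Measure Ω} {A : Ω → G.Core a}
    (hA : IsGaussianEmbedding P fun ω => G.coreMatrix σ a (A ω)) : AEMeasurable A P := by
  refine aemeasurable_pi_lambda _ fun i => ?_
  convert hA.aemeasurable_apply (fun e => i ⟨e, Finset.filter_subset _ _ e.2⟩)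
    (fun e => i ⟨e, Finset.sdiff_subset e.2⟩) using 2 with ω
  simp only [coreMatrix, Matrix.of_apply]
  congr 1
  ext e
  split_ifs <;> rfl

end EmbeddingNetwork

namespace EmbeddingNetwork

variable {V : Type u} {E : Type v} [Fintype V] [DecidableEq V] [Fintype E] [DecidableEq E]
  {G : EmbeddingNetwork V E} {σ : G.Linearization} {a : V} {s : Finset V} {Ω : Type w}
  [MeasurableSpace Ω] {P : Measure Ω} {A : (a : V) → Ω → G.Core a} {p : ℝ}

theorem IsGaussian.aemeasurable (hA : G.IsGaussian σ P A) (a : V) : AEMeasurable (A a) P :=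
  aemeasurable_of_isGaussianEmbedding_coreMatrix (hA.2 a)

theorem IsGaussian.indepFun_partialSketch (hA : G.IsGaussian σ P A) (ha : a ∉ s)
    (u : G.Idx G.input → ℝ) :
    IndepFun (fun ω => G.partialSketch σ u (fun b => A b ω) s) (A a) P :=
  indepFun_of_dependsOn hA.aemeasurable hA.1 (measurable_partialSketch u s)
    (fun _ _ hT => partialSketch_congr u hT) ha

theorem IsGaussian.lintegral_rpow_rowSize_mul_sum_partialSketch_insert_sq_le
    (hA : G.IsGaussian σ P A) (hs : ∀ b ∈ s, σ b < σ a) (hp : 1 ≤ |p|)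
    (hpa : |p| ≤ G.rowSize σ a / 4) (u : G.Idx G.input → ℝ) :
    ∫⁻ ω, ENNReal.ofReal (G.rowSize σ a *
        ∑ x, G.partialSketch σ u (fun b => A b ω) (insert a s) x ^ 2) ^ p ∂P
      ≤ ENNReal.ofReal (Real.exp (4 * p ^ 2 / G.rowSize σ a)) *
        ∫⁻ ω, ENNReal.ofReal (G.colSize σ a *
          ∑ x, G.partialSketch σ u (fun b => A b ω) s x ^ 2) ^ p ∂P := by
  have := hA.1.isProbabilityMeasure
  have hmeas : Measurable (Function.uncurry fun (f : (∀ e, Fin (G.dim e)) → ℝ) (t : G.Core a) =>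
      ENNReal.ofReal (G.rowSize σ a * ∑ x, sumOut (G.colEdges σ a)
        (fun x => t ((G.incident a).restrict x) * f x) x ^ 2) ^ p) := by
    unfold Function.uncurry sumOut
    fun_prop
  simp only [partialSketch_insert hs]
  rw [lintegral_eq_lintegral_lintegral_of_indepFun
      (X := fun ω => G.partialSketch σ u (fun b => A b ω) s)
      ((measurable_partialSketch u s).comp_aemeasurable (aemeasurable_pi_lambda _ hA.aemeasurable))
      (hA.aemeasurable a) (hA.indepFun_partialSketch (fun ha => (hs a ha).false) u) hmeas,
    ← lintegral_const_mul' _ _ ENNReal.ofReal_ne_top]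
  exact lintegral_mono fun ω => lintegral_rpow_rowSize_mul_sum_sq_le (hA.2 a) hp hpa
    (dependsOn_partialSketch hs u _)

theorem IsGaussian.lintegral_rpow_partialEnergy_insert_le (hA : G.IsGaussian σ P A)
    (hs : ∀ b ∈ s, σ b < σ a) (hp : 1 ≤ |p|) (hpa : |p| ≤ G.rowSize σ a / 4)
    (u : G.Idx G.input → ℝ) :
    ∫⁻ ω, ENNReal.ofReal (G.partialEnergy σ u (fun b => A b ω) (insert a s)) ^ p ∂P
      ≤ ENNReal.ofReal (Real.exp (4 * p ^ 2 / G.rowSize σ a)) *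
        ∫⁻ ω, ENNReal.ofReal (G.partialEnergy σ u (fun b => A b ω) s) ^ p ∂P := by
  have hrow : ∀ b, (0 : ℝ) < G.rowSize σ b := fun b => Nat.cast_pos.mpr (G.rowSize_pos σ b)
  have hcol : ∀ b, (0 : ℝ) < G.colSize σ b := fun b => Nat.cast_pos.mpr (G.colSize_pos σ b)
  obtain ⟨κ, hκ⟩ : ∃ κ : ℝ, Fintype.card (G.Idx G.input) *
      (∏ b ∈ s, (G.rowSize σ b / G.colSize σ b : ℝ)) / Fintype.card (∀ e, Fin (G.dim e))
        / G.colSize σ a = κ := ⟨_, rfl⟩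
  have hκ0 : 0 < κ := by
    rw [← hκ]
    exact div_pos (div_pos (mul_pos (Nat.cast_pos.mpr Fintype.card_pos) (Finset.prod_pos
      fun b _ => div_pos (hrow b) (hcol b))) (Nat.cast_pos.mpr Fintype.card_pos)) (hcol a)
  have hold : ∀ T, G.partialEnergy σ u T s
      = κ * (G.colSize σ a * ∑ x, G.partialSketch σ u T s x ^ 2) := fun T => by
    rw [partialEnergy, ← hκ, ← mul_assoc, div_mul_cancel₀ _ (hcol a).ne']
  have hnew : ∀ T, G.partialEnergy σ u T (insert a s)
      = κ * (G.rowSize σ a * ∑ x, G.partialSketch σ u T (insert a s) x ^ 2) := fun T => by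
    rw [partialEnergy, Finset.prod_insert fun ha => (hs a ha).false, ← hκ]
    ring
  have hκp0 : ENNReal.ofReal κ ≠ 0 := (ENNReal.ofReal_pos.mpr hκ0).ne'
  have hκp : ENNReal.ofReal κ ^ p ≠ ⊤ := ENNReal.rpow_ne_top_of_ne_zero hκp0 ENNReal.ofReal_ne_top
  simp only [hold, hnew, ENNReal.ofReal_mul hκ0.le,
    mul_rpow_of_ne_zero_of_ne_top hκp0 ENNReal.ofReal_ne_top]
  rw [lintegral_const_mul' _ _ hκp, lintegral_const_mul' _ _ hκp, mul_left_comm]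
  gcongr
  exact hA.lintegral_rpow_rowSize_mul_sum_partialSketch_insert_sq_le hs hp hpa u

theorem IsGaussian.lintegral_rpow_sum_embedding_mulVec_sq_le (hA : G.IsGaussian σ P A)
    (hp : 1 ≤ |p|) (hpa : ∀ a, |p| ≤ G.rowSize σ a / 4) (u : G.Idx G.input → ℝ) :
    ∫⁻ ω, ENNReal.ofReal (∑ r, (G.embedding (fun a => A a ω) *ᵥ u) r ^ 2) ^ p ∂P
      ≤ ENNReal.ofReal (Real.exp (∑ a, 4 * p ^ 2 / G.rowSize σ a)) *
        ENNReal.ofReal (∑ c, u c ^ 2) ^ p := by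
  have := hA.1.isProbabilityMeasure
  simp only [← partialEnergy_univ σ]
  induction Finset.univ (α := V) using Finset.induction_on_max_value σ with
  | empty => simp [partialEnergy_empty]
  | insert a s ha hmax ih =>
    have hs : ∀ b ∈ s, σ b < σ a := fun b hb =>
      (hmax b hb).lt_of_ne (σ.injective.ne (ne_of_mem_of_not_mem hb ha))
    rw [Finset.sum_insert ha, Real.exp_add, ENNReal.ofReal_mul (Real.exp_nonneg _), mul_assoc]
    exact (hA.lintegral_rpow_partialEnergy_insert_le hs hp (hpa a) u).trans (by gcongr)

theorem IsGaussian.aemeasurable_sum_embedding_mulVec_sq (hA : G.IsGaussian σ P A)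
    (u : G.Idx G.input → ℝ) :
    AEMeasurable (fun ω => ∑ r, (G.embedding (fun a => A a ω) *ᵥ u) r ^ 2) P := by
  have hmeas : Measurable fun T : (a : V) → G.Core a => G.partialEnergy σ u T Finset.univ :=
    (Finset.measurable_fun_sum _ fun x _ =>
      ((measurable_pi_apply x).comp (measurable_partialSketch u _)).pow_const 2).const_mul _
  simp only [← partialEnergy_univ σ]
  exact hmeas.comp_aemeasurable (aemeasurable_pi_lambda _ hA.aemeasurable)

end EmbeddingNetwork

/-! ### Concentration -/

section Concentration

variable {Ω : Type*} [MeasurableSpace Ω] {P : Measure Ω}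

theorem measureReal_le_exp_sub_of_lintegral_le {Z : Ω → ENNReal} (hZ : AEMeasurable Z P)
    {v w : ℝ} (hv : ∫⁻ ω, Z ω ∂P ≤ ENNReal.ofReal (Real.exp v)) {s : Set Ω}
    (hs : ∀ ω ∈ s, ENNReal.ofReal (Real.exp w) ≤ Z ω) : P.real s ≤ Real.exp (v - w) := by
  have hw : ENNReal.ofReal (Real.exp w) ≠ 0 := by simp [Real.exp_pos]
  refine ENNReal.toReal_le_of_le_ofReal (Real.exp_nonneg _) ?_
  rw [Real.exp_sub, ENNReal.ofReal_div_of_pos (Real.exp_pos _)]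
  calc P s ≤ P {ω | ENNReal.ofReal (Real.exp w) ≤ Z ω} := measure_mono hs
    _ ≤ (∫⁻ ω, Z ω ∂P) / ENNReal.ofReal (Real.exp w) :=
        meas_ge_le_lintegral_div hZ hw ENNReal.ofReal_ne_top
    _ ≤ _ := by gcongr

theorem ofReal_exp_rpow (x p : ℝ) :
    ENNReal.ofReal (Real.exp x) ^ p = ENNReal.ofReal (Real.exp (p * x)) := by
  rw [ENNReal.ofReal_rpow_of_pos (Real.exp_pos _), ← Real.exp_mul, mul_comm]

theorem exp_half_le_or_le_exp_neg_half_of_lt_abs_sub_one {y ε : ℝ} (hε₀ : 0 ≤ ε) (hε₂ : ε ≤ 2)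
    (hy : ε < |y - 1|) : Real.exp (ε / 2) ≤ y ∨ y ≤ Real.exp (-(ε / 2)) := by
  rcases lt_abs.mp hy with hy | hy
  · have hexp : |Real.exp (ε / 2) - 1 - ε / 2| ≤ (ε / 2) ^ 2 :=
      Real.abs_exp_sub_one_sub_id_le (by rw [abs_of_nonneg (by positivity)]; linarith)
    left
    nlinarith [(abs_le.mp hexp).2]
  · right
    linarith [Real.add_one_le_exp (-(ε / 2))]

theorem measureReal_lt_abs_sub_one_le_of_lintegral_rpow_le [IsFiniteMeasure P] {Y : Ω → ℝ}
    (hY : AEMeasurable Y P) {p v ε : ℝ} (hp : 0 ≤ p) (hε₀ : 0 ≤ ε) (hε₂ : ε ≤ 2)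
    (hpos : ∫⁻ ω, ENNReal.ofReal (Y ω) ^ p ∂P ≤ ENNReal.ofReal (Real.exp v))
    (hneg : ∫⁻ ω, ENNReal.ofReal (Y ω) ^ (-p) ∂P ≤ ENNReal.ofReal (Real.exp v)) :
    P.real {ω | ε < |Y ω - 1|} ≤ 2 * Real.exp (v - p * ε / 2) := by
  have hupper : P.real {ω | Real.exp (ε / 2) ≤ Y ω} ≤ Real.exp (v - p * ε / 2) := by
    refine measureReal_le_exp_sub_of_lintegral_le (hY.ennreal_ofReal.pow_const p) hpos
      fun ω hω => ?_
    rw [mul_div_assoc, ← ofReal_exp_rpow]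
    exact ENNReal.rpow_le_rpow (ENNReal.ofReal_le_ofReal hω) hp
  have hlower : P.real {ω | Y ω ≤ Real.exp (-(ε / 2))} ≤ Real.exp (v - p * ε / 2) := by
    refine measureReal_le_exp_sub_of_lintegral_le (hY.ennreal_ofReal.pow_const (-p)) hneg
      fun ω hω => ?_
    rw [mul_div_assoc, ← neg_mul_neg, ← ofReal_exp_rpow]
    exact rpow_le_rpow_of_le_of_nonpos (ENNReal.ofReal_le_ofReal hω) (neg_nonpos.mpr hp)
  calc P.real {ω | ε < |Y ω - 1|}
      ≤ P.real ({ω | Real.exp (ε / 2) ≤ Y ω} ∪ {ω | Y ω ≤ Real.exp (-(ε / 2))}) :=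
        measureReal_mono fun _ =>
          exp_half_le_or_le_exp_neg_half_of_lt_abs_sub_one hε₀ hε₂
    _ ≤ _ := measureReal_union_le _ _
    _ ≤ 2 * Real.exp (v - p * ε / 2) := by linarith

end Concentration

theorem two_mul_exp_neg_add_log_one_div_lt {δ : ℝ} (hδ : 0 < δ) :
    2 * Real.exp (-(1 + Real.log (1 / δ))) < δ := by
  have hexp : 2 * Real.exp (-1) < 1 := by
    rw [Real.exp_neg, ← div_eq_mul_inv, div_lt_one (Real.exp_pos _)]
    linarith [Real.exp_one_gt_d9]
  calc 2 * Real.exp (-(1 + Real.log (1 / δ))) = 2 * Real.exp (-1) * δ := by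
        rw [one_div, Real.log_inv, neg_add, neg_neg, Real.exp_add, Real.exp_log hδ, mul_assoc]
    _ < δ := mul_lt_of_lt_one_left hδ hexp

theorem exists_forall_one_add_log_one_div_le {δ₀ : ℝ} (hδ₀ : δ₀ < 1) :
    ∃ C : ℝ, 0 < C ∧
      ∀ δ, 0 < δ → δ ≤ δ₀ → 1 + Real.log (1 / δ) ≤ C * Real.log (1 / δ) := by
  rcases le_or_gt δ₀ 0 with hδ₀' | hδ₀'
  · exact ⟨1, one_pos, fun δ hδ hδδ₀ => by linarith⟩
  have hL₀ : 0 < Real.log (1 / δ₀) := Real.log_pos ((one_lt_div hδ₀').mpr hδ₀)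
  refine ⟨1 + 1 / Real.log (1 / δ₀), by positivity, fun δ hδ hδδ₀ => ?_⟩
  have hL : 1 ≤ Real.log (1 / δ) / Real.log (1 / δ₀) :=
    (one_le_div hL₀).mpr (Real.log_le_log (by positivity) (by gcongr))
  linear_combination hL

theorem EmbeddingNetwork.IsGaussian.measureReal_lt_abs_sub_one_le {V : Type u} {E : Type v}
    [Fintype V] [DecidableEq V] [Fintype E] [DecidableEq E] {G : EmbeddingNetwork V E}
    {σ : G.Linearization} {Ω : Type w} [MeasurableSpace Ω] {P : Measure Ω}
    {A : (a : V) → Ω → G.Core a} (hA : G.IsGaussian σ P A) {B ε : ℝ} (hε₀ : 0 < ε) (hε₂ : ε ≤ 2)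
    (hBε : 16 ≤ B * ε) (hB : ∀ a, Fintype.card V * B ≤ G.rowSize σ a)
    {u : G.Idx G.input → ℝ} (hu : ∑ c, u c ^ 2 = 1) :
    P.real {ω | ε < |∑ r, (G.embedding (fun a => A a ω) *ᵥ u) r ^ 2 - 1|}
      ≤ 2 * Real.exp (-(B * ε ^ 2 / 64)) := by
  have := hA.1.isProbabilityMeasure
  have hB₀ : 0 < B := pos_of_mul_pos_left (by linarith) hε₀.le
  have hrow : ∀ a, B ≤ G.rowSize σ a := fun a => (hB a).trans' <|
    le_mul_of_one_le_left hB₀.le (Nat.one_le_cast.mpr (Fintype.card_pos_iff.mpr ⟨a⟩))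
  have hsum : ∀ p : ℝ, ∑ a, 4 * p ^ 2 / G.rowSize σ a ≤ 4 * p ^ 2 / B := fun p => by
    rcases isEmpty_or_nonempty V with hV | hV
    · rw [Fintype.sum_empty]
      positivity
    · calc ∑ a, 4 * p ^ 2 / G.rowSize σ a ≤ ∑ _a : V, 4 * p ^ 2 / (Fintype.card V * B) := by
            gcongr with a
            exact hB a
        _ = 4 * p ^ 2 / B := by
            rw [Finset.sum_const, Finset.card_univ, nsmul_eq_mul]
            field_simp
  have hmoment : ∀ p : ℝ, |p| = B * ε / 16 →
      ∫⁻ ω, ENNReal.ofReal (∑ r, (G.embedding (fun a => A a ω) *ᵥ u) r ^ 2) ^ p ∂P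
        ≤ ENNReal.ofReal (Real.exp (B * ε ^ 2 / 64)) := fun p hp => by
    have hp₂ : 4 * p ^ 2 / B = B * ε ^ 2 / 64 := by
      rw [← sq_abs, hp]
      field_simp
      norm_num
    refine (hA.lintegral_rpow_sum_embedding_mulVec_sq_le (by linarith)
      (fun a => ?_) u).trans ?_
    · nlinarith [hrow a]
    · rw [hu, ENNReal.ofReal_one, ENNReal.one_rpow, mul_one]
      gcongr
      exact (hsum p).trans_eq hp₂
  have hp₀ : 0 ≤ B * ε / 16 := by positivity
  convert measureReal_lt_abs_sub_one_le_of_lintegral_rpow_le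
    (hA.aemeasurable_sum_embedding_mulVec_sq u) hp₀
    hε₀.le hε₂ (hmoment _ (abs_of_nonneg hp₀)) (hmoment _ (by rw [abs_neg, abs_of_nonneg hp₀]))
    using 3
  ring

theorem theorem3p1 (δ₀ : ℝ) (hδ₀ : δ₀ < 1) :
    ∃ C : ℝ, 0 < C ∧
      ∀ (V : Type u) (E : Type v) (Ω : Type w) [Fintype V] [DecidableEq V] [Fintype E]
        [DecidableEq E] [MeasurableSpace Ω] (P : Measure Ω) [IsProbabilityMeasure P]
        (G : EmbeddingNetwork V E) (A : (a : V) → Ω → G.Core a) (ε δ : ℝ),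
        0 < ε → ε ≤ 1 → 0 < δ → δ ≤ δ₀ →
        (∃ σ : G.Linearization, G.IsGaussian σ P A ∧
          ∀ a : V, C * (Fintype.card V * Real.log (1 / δ) / ε ^ 2) ≤ (G.rowSize σ a : ℝ)) →
        IsAccurateEmbedding P (fun ω => G.embedding fun a => A a ω) ε δ := by
  obtain ⟨C, hC₀, hC⟩ := exists_forall_one_add_log_one_div_le hδ₀
  refine ⟨64 * C, by positivity, ?_⟩
  intro V E Ω _ _ _ _ _ P _ G A ε δ hε hε₁ hδ hδδ₀ ⟨σ, hA, hrow⟩ x hx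
  set L := Real.log (1 / δ)
  have hL : 0 ≤ L := Real.log_nonneg (by rw [one_le_div hδ]; linarith)
  have hCL : 1 + L ≤ C * L := hC δ hδ hδδ₀
  have hBε : 16 ≤ 64 * C * L / ε ^ 2 * ε := by
    rw [div_mul_eq_mul_div, le_div_iff₀ (by positivity)]
    nlinarith
  have hx₁ : ∑ c, x.ofLp c ^ 2 = 1 := by rw [← EuclideanSpace.real_norm_sq_eq, hx, one_pow]
  simp only [EuclideanSpace.real_norm_sq_eq]
  calc _ ≤ 2 * Real.exp (-(64 * C * L / ε ^ 2 * ε ^ 2 / 64)) :=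
        hA.measureReal_lt_abs_sub_one_le hε (by linarith) hBε
          (fun a => (hrow a).trans_eq' (by ring)) hx₁
    _ = 2 * Real.exp (-(C * L)) := by field_simp
    _ ≤ 2 * Real.exp (-(1 + L)) := by gcongr
    _ < δ := two_mul_exp_neg_add_log_one_div_lt hδ
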